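/- Let $H$ be a complex Hilbert space (of arbitrary dimension), let $X$ be a set, and let $x\mapsto|\varphi_x\rangle$ be a map from $X$ to the unit vectors of $H$. The confusability graph of $\varphi$ has vertex set $X$, and two vertices $x,y$ are adjacent whenever $\langle\varphi_x|\varphi_y\rangle\neq 0$. For a connected component of this graph with vertex set $X_k\subseteq X$, let $S_k$ be the closed linear span of $\{|\varphi_x\rangle : x\in X_k\}$. Let $\mathcal C$ be a quantum channel on $H$, that is, a completely positive, trace-preserving, normal linear map from the trace-class operators on $H$ to the trace-class operators on $H$, and suppose that $\mathcal C(|\varphi_x\rangle\langle\varphi_x|)=|\varphi_x\rangle\langle\varphi_x|$ for every $x\in X$. Then, for every connected component, $S_k$ is decoherence free for $\mathcal C$: every density operator $\rho$ on $H$ (positive, trace class, of trace one) whose support lies in $S_k$ satisfies $\mathcal C(\rho)=\rho$. In particular $\mathcal C(|\psi\rangle\langle\psi|)=|\psi\rangle\langle\psi|$ for every unit vector $\psi\in S_k$. -/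

import Mathlib

open scoped ComplexOrder InnerProductSpace

namespace Confusability

noncomputable section

variable {H : Type*} [NormedAddCommGroup H] [InnerProductSpace ℂ H] [CompleteSpace H]

/-! ### Trace-class operators -/

variable (H) in
/-- The index set of a chosen Hilbert (orthonormal) basis of `H`. -/
def basisSet : Set H := (exists_hilbertBasis ℂ H).choose

variable (H) in
/-- A chosen Hilbert (orthonormal) basis of `H`. Neither the trace class nor the trace of a
trace-class operator depends on this choice. -/
def basis : HilbertBasis (basisSet H) ℂ H := (exists_hilbertBasis ℂ H).choose_spec.choose

/-- `T` is trace class if `Tr |T| = ∑ ⟨eᵢ, |T| eᵢ⟩` is finite, where `|T| = √(T† T)`. -/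
def IsTraceClass (T : H →L[ℂ] H) : Prop :=
  Summable fun i : basisSet H => (⟪basis H i, CFC.abs T (basis H i)⟫_ℂ).re

/-- The squared Hilbert-Schmidt norm. -/
def hsSq (A : H →L[ℂ] H) : ENNReal := ∑' i : basisSet H, ‖A (basis H i)‖ₑ ^ 2

theorem tsum_enorm_inner_sq (x : H) :
    ∑' i : basisSet H, ‖⟪basis H i, x⟫_ℂ‖ₑ ^ 2 = ‖x‖ₑ ^ 2 := by
  have h := (basis H).hasSum_inner_mul_inner x x
  have h2 : HasSum (fun i => ‖⟪basis H i, x⟫_ℂ‖ ^ 2) (‖x‖ ^ 2) := by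
    have h3 := (Complex.hasSum_re h)
    convert h3 using 1
    · ext i
      rw [← inner_conj_symm x (basis H i), ← Complex.normSq_eq_conj_mul_self, Complex.ofReal_re,
        Complex.normSq_eq_norm_sq]
    · rw [inner_self_eq_norm_sq_to_K]
      norm_cast
  have h4 : ∀ y : ℝ, 0 ≤ y → ENNReal.ofReal (y ^ 2) = ENNReal.ofReal y ^ 2 :=
    fun y hy => ENNReal.ofReal_pow hy 2
  simp_rw [← ofReal_norm, ← h4 _ (norm_nonneg _)]
  rw [← h2.tsum_eq, ENNReal.ofReal_tsum_of_nonneg (fun i => by positivity) h2.summable]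

theorem hsSq_adjoint (A : H →L[ℂ] H) : hsSq (star A) = hsSq A := by
  unfold hsSq
  simp_rw [← tsum_enorm_inner_sq (H := H) (_ : H)]
  rw [ENNReal.tsum_comm]
  refine tsum_congr fun i => tsum_congr fun j => ?_
  rw [ContinuousLinearMap.star_eq_adjoint, ContinuousLinearMap.adjoint_inner_right,
    ← inner_conj_symm]
  simp only [← ofReal_norm, RCLike.norm_conj]

theorem hsSq_comp_le (B A : H →L[ℂ] H) : hsSq (B * A) ≤ ‖B‖ₑ ^ 2 * hsSq A := by
  unfold hsSq
  rw [← ENNReal.tsum_mul_left]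
  refine ENNReal.tsum_le_tsum fun i => ?_
  rw [← mul_pow]
  gcongr
  exact B.le_opNorm_enorm _

theorem summable_of_hsSq {A : H →L[ℂ] H} (h : hsSq A ≠ ⊤) :
    Summable fun i : basisSet H => ‖A (basis H i)‖ ^ 2 := by
  have := ENNReal.summable_toReal h
  simpa using this

theorem hsSq_of_summable {A : H →L[ℂ] H}
    (h : Summable fun i : basisSet H => ‖A (basis H i)‖ ^ 2) : hsSq A ≠ ⊤ := by
  have h2 := ENNReal.ofReal_tsum_of_nonneg (fun i => by positivity) h
  have h3 : hsSq A = ENNReal.ofReal (∑' i, ‖A (basis H i)‖ ^ 2) := by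
    rw [h2, hsSq]
    refine tsum_congr fun i => ?_
    rw [ENNReal.ofReal_pow (norm_nonneg _), ofReal_norm]
  rw [h3]
  exact ENNReal.ofReal_ne_top

/-- A positive operator is the square of a self-adjoint one. -/
theorem exists_sqrt {P : H →L[ℂ] H} (hP : 0 ≤ P) :
    ∃ R : H →L[ℂ] H, star R = R ∧ R * R = P :=
  ⟨CFC.sqrt P, (CFC.sqrt_nonneg P).isSelfAdjoint, CFC.sqrt_mul_sqrt_self P hP⟩

theorem inner_mul_self {R : H →L[ℂ] H} (hR : star R = R) (x y : H) :
    ⟪x, (R * R) y⟫_ℂ = ⟪R x, R y⟫_ℂ := by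
  conv_lhs => rw [← hR]
  rw [ContinuousLinearMap.star_eq_adjoint, ContinuousLinearMap.mul_apply,
    ContinuousLinearMap.adjoint_inner_right, ← ContinuousLinearMap.star_eq_adjoint, hR]

theorem summable_comp_of_nonneg {P : H →L[ℂ] H} (hP : 0 ≤ P)
    (h : Summable fun i : basisSet H => (⟪basis H i, P (basis H i)⟫_ℂ).re) (B : H →L[ℂ] H) :
    Summable fun i : basisSet H => (⟪basis H i, (B * P) (basis H i)⟫_ℂ).re := by
  obtain ⟨R, hR, rfl⟩ := exists_sqrt hP
  have hR2 : Summable fun i : basisSet H => ‖R (basis H i)‖ ^ 2 := by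
    convert h using 2 with i
    rw [inner_mul_self hR, inner_self_eq_norm_sq_to_K]
    norm_cast
  have hfin := hsSq_of_summable hR2
  have hRB : Summable fun i : basisSet H => ‖(R * star B) (basis H i)‖ ^ 2 := by
    apply summable_of_hsSq
    rw [← hsSq_adjoint, star_mul, star_star, hR]
    refine ne_top_of_le_ne_top ?_ (hsSq_comp_le B R)
    exact ENNReal.mul_ne_top (by simp) hfin
  refine Summable.of_norm_bounded (hRB.add hR2) fun i => ?_
  have h1 : ⟪basis H i, (B * (R * R)) (basis H i)⟫_ℂ
      = ⟪(R * star B) (basis H i), R (basis H i)⟫_ℂ := by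
    rw [ContinuousLinearMap.mul_apply B, ← ContinuousLinearMap.adjoint_inner_left,
      inner_mul_self hR]
    rfl
  rw [h1]
  refine (Complex.abs_re_le_norm _).trans ((norm_inner_le_norm _ _).trans ?_)
  nlinarith [sq_nonneg (‖(R * star B) (basis H i)‖ - ‖R (basis H i)‖),
    sq_nonneg ‖(R * star B) (basis H i)‖, sq_nonneg ‖R (basis H i)‖]

/-- Factorization of an operator dominated by another one. -/
theorem exists_factor (A B : H →L[ℂ] H) (h : ∀ x, ‖B x‖ ≤ ‖A x‖) :
    ∃ W : H →L[ℂ] H, W * A = B := by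
  let K : Submodule ℂ H := (LinearMap.range A.toLinearMap).topologicalClosure
  have hK : ∀ x, A x ∈ K := fun x =>
    Submodule.le_topologicalClosure _ (LinearMap.mem_range_self A.toLinearMap x)
  let e : H →ₗ[ℂ] K := A.toLinearMap.codRestrict K hK
  have he : DenseRange e := by
    intro y
    rw [closure_subtype]
    have : (Subtype.val '' Set.range e) = (LinearMap.range A.toLinearMap : Set H) := by
      rw [← Set.range_comp]; rfl
    rw [this]
    exact y.2
  have hn : ∃ c : ℝ, ∀ x, ‖B.toLinearMap x‖ ≤ c * ‖e x‖ := ⟨1, fun x => by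
    rw [one_mul]; exact h x⟩
  have : CompleteSpace K := (Submodule.isClosed_topologicalClosure _).completeSpace_coe
  refine ⟨(B.toLinearMap.extendOfNorm e).comp K.orthogonalProjectionOnto, ?_⟩
  ext x
  have h1 : K.orthogonalProjectionOnto (A x) = e x :=
    Submodule.orthogonalProjectionOnto_mem_subspace_eq_self (⟨A x, hK x⟩ : K)
  rw [ContinuousLinearMap.mul_apply, ContinuousLinearMap.comp_apply, h1,
    LinearMap.extendOfNorm_eq he hn]
  rfl

theorem norm_abs_apply (T : H →L[ℂ] H) (x : H) : ‖CFC.abs T x‖ = ‖T x‖ := by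
  have h1 : star (CFC.abs T) = CFC.abs T := (CFC.abs_nonneg T).isSelfAdjoint
  have h2 := inner_mul_self h1 x x
  rw [CFC.abs_mul_abs, ContinuousLinearMap.star_eq_adjoint, ContinuousLinearMap.mul_apply,
    ContinuousLinearMap.adjoint_inner_right, inner_self_eq_norm_sq_to_K,
    inner_self_eq_norm_sq_to_K] at h2
  have h3 : ‖T x‖ ^ 2 = ‖CFC.abs T x‖ ^ 2 := by exact_mod_cast h2
  exact ((pow_left_inj₀ (norm_nonneg _) (norm_nonneg _) two_ne_zero).1 h3).symm

theorem exists_eq_mul_abs (T : H →L[ℂ] H) : ∃ V : H →L[ℂ] H, V * CFC.abs T = T :=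
  exists_factor _ _ fun x => (norm_abs_apply T x).ge

theorem exists_abs_eq_mul (T : H →L[ℂ] H) : ∃ W : H →L[ℂ] H, W * T = CFC.abs T :=
  exists_factor _ _ fun x => (norm_abs_apply T x).le

variable (H) in
/-- The space of trace-class operators on `H`. -/
def TraceClass : Submodule ℂ (H →L[ℂ] H) where
  carrier := {T | IsTraceClass T}
  zero_mem' := by simp [IsTraceClass, summable_zero]
  add_mem' := by
    intro S T hS hT
    obtain ⟨W, hW⟩ := exists_abs_eq_mul (S + T)
    obtain ⟨V, hV⟩ := exists_eq_mul_abs S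
    obtain ⟨V', hV'⟩ := exists_eq_mul_abs T
    have h1 := summable_comp_of_nonneg (CFC.abs_nonneg S) hS (W * V)
    have h2 := summable_comp_of_nonneg (CFC.abs_nonneg T) hT (W * V')
    rw [mul_assoc, hV] at h1
    rw [mul_assoc, hV'] at h2
    show IsTraceClass (S + T)
    unfold IsTraceClass
    rw [← hW]
    convert h1.add h2 using 2 with i
    rw [mul_add, ContinuousLinearMap.add_apply, inner_add_right, Complex.add_re]
  smul_mem' := by
    intro c T hT
    obtain ⟨W, hW⟩ := exists_abs_eq_mul (c • T)
    obtain ⟨V, hV⟩ := exists_eq_mul_abs T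
    have h1 := summable_comp_of_nonneg (CFC.abs_nonneg T) hT (W * (c • V))
    show IsTraceClass (c • T)
    unfold IsTraceClass
    rw [mul_assoc, smul_mul_assoc, hV, hW] at h1
    exact h1

/-- The trace `Tr T = ∑ ⟨eᵢ, T eᵢ⟩` of a trace-class operator (the series converges absolutely). -/
def trace (T : TraceClass H) : ℂ := ∑' i : basisSet H, ⟪basis H i, T.1 (basis H i)⟫_ℂ

theorem rankOne_self_mem_traceClass (ψ : H) :
    InnerProductSpace.rankOne ℂ ψ ψ ∈ TraceClass H := by
  show IsTraceClass _
  have h0 : (0 : H →L[ℂ] H) ≤ InnerProductSpace.rankOne ℂ ψ ψ := by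
    rw [ContinuousLinearMap.nonneg_iff_isPositive]
    exact InnerProductSpace.isPositive_rankOne_self ψ
  unfold IsTraceClass
  rw [CFC.abs_of_nonneg _ h0]
  have h := Complex.hasSum_re ((basis H).hasSum_inner_mul_inner ψ ψ)
  convert h.summable using 2 with i
  simp [InnerProductSpace.rankOne_apply]

/-- The operator `|ψ⟩⟨ψ|`, the (projector on the) pure state `ψ` if `ψ` is a unit vector. -/
def pureState (ψ : H) : TraceClass H :=
  ⟨InnerProductSpace.rankOne ℂ ψ ψ, rankOne_self_mem_traceClass ψ⟩

/-- Density operators: positive trace-class operators of trace one. -/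
def IsDensity (ρ : TraceClass H) : Prop := (0 : H →L[ℂ] H) ≤ ρ.1 ∧ trace ρ = 1

/-! ### Quantum channels -/

/-- An `n × n` matrix of operators on `H` is positive if it is a positive operator on `Hⁿ`, that
is `⟨v, M v⟩ = ∑ i j, ⟨vᵢ, Mᵢⱼ vⱼ⟩` is real and nonnegative for all `v` in `Hⁿ`. -/
def BlockPositive {n : ℕ} (M : Matrix (Fin n) (Fin n) (TraceClass H)) : Prop :=
  ∀ v : Fin n → H, 0 ≤ ∑ i, ∑ j, ⟪v i, (M i j).1 (v j)⟫_ℂ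

/-- A quantum channel: a completely positive, trace-preserving, normal linear map on trace-class
operators. -/
structure IsQuantumChannel (C : TraceClass H →ₗ[ℂ] TraceClass H) : Prop where
  /-- Applied entrywise, the map sends positive block matrices to positive block matrices. -/
  completelyPositive : ∀ (n : ℕ) (M : Matrix (Fin n) (Fin n) (TraceClass H)),
    BlockPositive M → BlockPositive (M.map C)
  tracePreserving : ∀ ρ : TraceClass H, trace (C ρ) = trace ρ
  /-- The map preserves least upper bounds of upward directed sets of positive operators. -/
  normal : ∀ (D : Set (TraceClass H)) (ρ : TraceClass H), D.Nonempty →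
    DirectedOn (fun σ τ => σ.1 ≤ τ.1) D → (∀ σ ∈ D, (0 : H →L[ℂ] H) ≤ σ.1) →
    IsLUB ((fun σ : TraceClass H => σ.1) '' D) ρ.1 →
    IsLUB ((fun σ : TraceClass H => (C σ).1) '' D) (C ρ).1

/-- A closed subspace `S` is decoherence free for `C` if `C` preserves every (pure or mixed) state
with support in `S`. For a self-adjoint `ρ` the support is the closure of the range. -/
def IsDecoherenceFree (C : TraceClass H →ₗ[ℂ] TraceClass H) (S : Submodule ℂ H) : Prop :=
  ∀ ρ : TraceClass H, IsDensity ρ → (∀ v : H, ρ.1 v ∈ S) → C ρ = ρ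

/-! ### Confusability graphs -/

/-- The confusability graph of `φ : X → H`: two different vertices are adjacent if the
corresponding vectors are not orthogonal. (Loops do not matter for connectivity.) -/
def confusabilityGraph {X : Type*} (φ : X → H) : SimpleGraph X where
  Adj x y := x ≠ y ∧ ⟪φ x, φ y⟫_ℂ ≠ 0
  symm := ⟨fun _ _ h => ⟨h.1.symm, fun h0 => h.2 (inner_eq_zero_symm.1 h0)⟩⟩
  loopless := ⟨fun _ h => h.1 rfl⟩

/-- The closed subspace `S_k` spanned by the vectors in a connected component `k`. -/
def componentSubspace {X : Type*} (φ : X → H) (k : (confusabilityGraph φ).ConnectedComponent) :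
    Submodule ℂ H :=
  (Submodule.span ℂ (φ '' k.supp)).topologicalClosure

end

end Confusability

namespace Confusability

open InnerProductSpace

/-! ### Operators |u⟩⟨v| and positive block matrices -/

variable {H : Type*} [NormedAddCommGroup H] [InnerProductSpace ℂ H] [CompleteSpace H]

/-! Fixing pure states constrains the coherences between them. If `C` fixes |x⟩⟨x| and |y⟩⟨y|,
complete positivity gives a Cauchy-Schwarz bound on C(|x⟩⟨y|), which forces C(|x⟩⟨y|) = c |x⟩⟨y|
(`map_ketBra_eq_smul`). Trace preservation gives c⟨y, x⟩ = ⟨y, x⟩, so c = 1 along an edge of the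
graph. Positivity of a 3 × 3 determinant makes "c = 1" transitive (`map_ketBra_trans`), so it holds
throughout a component.

Since (u, v) ↦ C(|u⟩⟨v|) is sesquilinear and bounded (`norm_map_ketBra_le`), |u⟩⟨v| is then fixed
for all u, v in the closed span S. Finally, a density operator ρ = R² supported in S is the supremum
of finite sums of the |R eᵢ⟩⟨R eᵢ| with R eᵢ in S, and normality carries the fixed-point property
over to ρ. -/

theorem rankOne_mem_traceClass (u v : H) : rankOne ℂ u v ∈ TraceClass H := by
  -- Polarization reduces to the operators |w⟩⟨w|.
  have h : rankOne ℂ u v = (1 / 4 : ℂ) • (rankOne ℂ (u + v) (u + v) - rankOne ℂ (u - v) (u - v)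
      + Complex.I • rankOne ℂ (u + Complex.I • v) (u + Complex.I • v)
      - Complex.I • rankOne ℂ (u - Complex.I • v) (u - Complex.I • v)) := by
    simp only [map_add, map_sub, add_apply, sub_apply, map_smul, map_smulₛₗ, smul_apply,
      Complex.conj_I]
    match_scalars <;> ring_nf <;> norm_num [Complex.I_sq]
  rw [h]
  have hm := rankOne_self_mem_traceClass (H := H)
  exact Submodule.smul_mem _ _ (Submodule.sub_mem _ (Submodule.add_mem _
    (Submodule.sub_mem _ (hm _) (hm _)) (Submodule.smul_mem _ _ (hm _)))
    (Submodule.smul_mem _ _ (hm _)))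

/-- The operator `|u⟩⟨v|` as a trace-class operator. -/
noncomputable def ketBra : H →ₗ[ℂ] H →ₗ⋆[ℂ] TraceClass H :=
  LinearMap.mk₂'ₛₗ (RingHom.id ℂ) (starRingEnd ℂ)
    (fun u v => ⟨rankOne ℂ u v, rankOne_mem_traceClass u v⟩)
    (fun u u' v => by ext1; simp) (fun c u v => by ext1; simp)
    (fun u v v' => by ext1; simp) (fun c u v => by ext1; simp)

@[simp]
theorem coe_ketBra (u v : H) : (ketBra u v : H →L[ℂ] H) = rankOne ℂ u v := rfl

theorem hasSum_inner_ketBra (u v : H) :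
    HasSum (fun i : basisSet H => ⟪basis H i, (ketBra u v).1 (basis H i)⟫_ℂ) ⟪v, u⟫_ℂ := by
  simpa [rankOne_apply] using (basis H).hasSum_inner_mul_inner v u

theorem trace_ketBra (u v : H) : trace (ketBra u v) = ⟪v, u⟫_ℂ :=
  (hasSum_inner_ketBra u v).tsum_eq

/-- The block matrix `|w₁ ⊕ ⋯ ⊕ wₙ⟩⟨w₁ ⊕ ⋯ ⊕ wₙ|` is positive. -/
theorem blockPositive_ketBra {n : ℕ} (w : Fin n → H) :
    BlockPositive (Matrix.of fun i j => ketBra (w i) (w j)) := by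
  intro v
  have h : ∑ i, ∑ j, ⟪v i, (ketBra (w i) (w j)).1 (v j)⟫_ℂ
      = star (∑ j, ⟪w j, v j⟫_ℂ) * ∑ j, ⟪w j, v j⟫_ℂ := by
    rw [star_sum, Finset.sum_mul_sum]
    refine Finset.sum_congr rfl fun i _ => Finset.sum_congr rfl fun j _ => ?_
    rw [coe_ketBra, rankOne_apply, inner_smul_right, ← inner_conj_symm (v i) (w i), mul_comm]
    rfl
  simp only [Matrix.of_apply]
  rw [h]
  exact star_mul_self_nonneg _

/-- Compressing a positive block matrix by vectors gives a positive semidefinite matrix. -/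
theorem BlockPositive.posSemidef {n : ℕ} {M : Matrix (Fin n) (Fin n) (TraceClass H)}
    (hM : BlockPositive M) (v : Fin n → H) :
    (Matrix.of fun i j => ⟪v i, (M i j).1 (v j)⟫_ℂ).PosSemidef := by
  have key : ∀ s : Fin n → ℂ,
      0 ≤ star s ⬝ᵥ ((Matrix.of fun i j => ⟪v i, (M i j).1 (v j)⟫_ℂ).mulVec s) := by
    intro s
    have h := hM fun i => s i • v i
    convert h using 1
    simp only [dotProduct, Matrix.mulVec, Finset.mul_sum, Matrix.of_apply, Pi.star_apply, map_smul,
      inner_smul_left, inner_smul_right]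
    refine Finset.sum_congr rfl fun i _ => Finset.sum_congr rfl fun j _ => ?_
    simp only [RCLike.star_def]
    ring
  refine Matrix.PosSemidef.of_dotProduct_mulVec_nonneg ?_ key
  -- Over ℂ, a matrix with real quadratic form is Hermitian, so `key` suffices.
  rw [← Matrix.isSymmetric_toEuclideanLin_iff, LinearMap.isSymmetric_iff_inner_map_self_real]
  intro x
  have h : star _ = _ := IsSelfAdjoint.of_nonneg (key x.ofLp)
  rw [inner_conj_symm, ← inner_conj_symm _ x, EuclideanSpace.inner_eq_star_dotProduct,
    dotProduct_comm]
  exact h.symm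

/-- Cauchy-Schwarz for positive `2 × 2` block matrices. -/
theorem BlockPositive.norm_sq_le {M : Matrix (Fin 2) (Fin 2) (TraceClass H)}
    (hM : BlockPositive M) (a b : H) :
    ‖⟪a, (M 0 1).1 b⟫_ℂ‖ ^ 2 ≤ ‖⟪a, (M 0 0).1 a⟫_ℂ‖ * ‖⟪b, (M 1 1).1 b⟫_ℂ‖ := by
  have h := hM.posSemidef ![a, b]
  have hd := h.det_nonneg
  have hh := h.isHermitian.apply 0 1
  have h0 : 0 ≤ ⟪a, (M 0 0).1 a⟫_ℂ := h.diag_nonneg (i := 0)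
  have h1 : 0 ≤ ⟪b, (M 1 1).1 b⟫_ℂ := h.diag_nonneg (i := 1)
  rw [Matrix.det_fin_two] at hd
  simp only [Matrix.of_apply, Matrix.cons_val_zero, Matrix.cons_val_one] at hd hh
  have h3 : ⟪b, (M 1 0).1 a⟫_ℂ = star ⟪a, (M 0 1).1 b⟫_ℂ := by rw [← hh, star_star]
  rw [h3, RCLike.star_def, Complex.mul_conj, Complex.normSq_eq_norm_sq,
    Complex.eq_coe_norm_of_nonneg h0, Complex.eq_coe_norm_of_nonneg h1, sub_nonneg] at hd
  exact_mod_cast hd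

theorem IsQuantumChannel.blockPositive_map_ketBra {C : TraceClass H →ₗ[ℂ] TraceClass H} (hC : IsQuantumChannel C)
    {n : ℕ} (w : Fin n → H) : BlockPositive (Matrix.of fun i j => C (ketBra (w i) (w j))) :=
  hC.completelyPositive n _ (blockPositive_ketBra w)

theorem IsQuantumChannel.norm_sq_inner_map_ketBra_le {C : TraceClass H →ₗ[ℂ] TraceClass H}
    (hC : IsQuantumChannel C) (u v a b : H) :
    ‖⟪a, (C (ketBra u v)).1 b⟫_ℂ‖ ^ 2
      ≤ ‖⟪a, (C (ketBra u u)).1 a⟫_ℂ‖ * ‖⟪b, (C (ketBra v v)).1 b⟫_ℂ‖ :=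
  (hC.blockPositive_map_ketBra ![u, v]).norm_sq_le a b

/-! ### Coherences between fixed pure states -/

/-- An operator whose matrix elements are dominated by those of `|x⟩⟨y|` is a multiple of it. -/
theorem eq_smul_rankOne_of_inner_le {E : Type*} [NormedAddCommGroup E] [InnerProductSpace ℂ E]
    {A : E →L[ℂ] E} {x y : E} (hx : ‖x‖ = 1) (hy : ‖y‖ = 1)
    (h : ∀ a b, ‖⟪a, A b⟫_ℂ‖ ^ 2 ≤ ‖⟪a, x⟫_ℂ‖ ^ 2 * ‖⟪y, b⟫_ℂ‖ ^ 2) :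
    A = ⟪x, A y⟫_ℂ • rankOne ℂ x y := by
  have h0 : ∀ a b, ⟪a, x⟫_ℂ = 0 ∨ ⟪y, b⟫_ℂ = 0 → ⟪a, A b⟫_ℂ = 0 := by
    intro a b hab
    have := h a b
    rw [← norm_eq_zero, ← sq_eq_zero_iff]
    refine le_antisymm (this.trans_eq ?_) (by positivity)
    rcases hab with hab | hab <;> simp [hab]
  have hxx : ⟪x, x⟫_ℂ = 1 := by simp [inner_self_eq_norm_sq_to_K, hx]
  have hyy : ⟪y, y⟫_ℂ = 1 := by simp [inner_self_eq_norm_sq_to_K, hy]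
  refine ContinuousLinearMap.ext fun b => ext_inner_left ℂ fun a => ?_
  -- Only the components of b along y and of a along x contribute to ⟨a, A b⟩.
  have h1 := h0 a (b - ⟪y, b⟫_ℂ • y) (Or.inr (by rw [inner_sub_right, inner_smul_right, hyy, mul_one, sub_self]))
  have h2 := h0 (a - ⟪x, a⟫_ℂ • x) y (Or.inl (by
    rw [inner_sub_left, inner_smul_left, hxx, inner_conj_symm, mul_one, sub_self]))
  simp only [map_sub, map_smul, inner_sub_right, inner_sub_left, inner_smul_left,
    inner_smul_right, inner_conj_symm, sub_eq_zero] at h1 h2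
  simp only [smul_apply, rankOne_apply, inner_smul_right]
  rw [h1, h2]
  ring

variable {C : TraceClass H →ₗ[ℂ] TraceClass H}

/-- Because the diagonal blocks are fixed, Cauchy-Schwarz bounds the matrix elements of C(|x⟩⟨y|) by
those of |x⟩⟨y|. -/
theorem IsQuantumChannel.map_ketBra_eq_smul (hC : IsQuantumChannel C) {x y : H}
    (hx : ‖x‖ = 1) (hy : ‖y‖ = 1) (hfx : C (ketBra x x) = ketBra x x)
    (hfy : C (ketBra y y) = ketBra y y) :
    C (ketBra x y) = ⟪x, (C (ketBra x y)).1 y⟫_ℂ • ketBra x y := by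
  refine Subtype.ext (eq_smul_rankOne_of_inner_le hx hy fun a b => ?_)
  refine (hC.norm_sq_inner_map_ketBra_le x y a b).trans_eq ?_
  rw [hfx, hfy]
  simp only [coe_ketBra, rankOne_apply, inner_smul_right, norm_mul]
  rw [norm_inner_symm x a, norm_inner_symm b y]
  ring

theorem IsQuantumChannel.map_ketBra_of_inner_ne_zero (hC : IsQuantumChannel C) {x y : H}
    (hx : ‖x‖ = 1) (hy : ‖y‖ = 1) (hfx : C (ketBra x x) = ketBra x x)
    (hfy : C (ketBra y y) = ketBra y y) (hxy : ⟪x, y⟫_ℂ ≠ 0) :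
    C (ketBra x y) = ketBra x y := by
  have h := hC.map_ketBra_eq_smul hx hy hfx hfy
  set c := ⟪x, (C (ketBra x y)).1 y⟫_ℂ
  have ht := hC.tracePreserving (ketBra x y)
  have h2 : trace (c • ketBra x y) = c * ⟪y, x⟫_ℂ := by
    rw [← inner_smul_right, ← trace_ketBra, map_smul, LinearMap.smul_apply]
  rw [h, h2, trace_ketBra] at ht
  have hyx : ⟪y, x⟫_ℂ ≠ 0 := fun h0 => hxy (inner_eq_zero_symm.1 h0)
  rw [h, mul_right_cancel₀ hyx (ht.trans (one_mul _).symm), one_smul]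

/-- Apply `C` to the positive 3 × 3 block matrix built from x, y, z and compress by the same
vectors. The resulting positive matrix has all entries 1 except c and its conjugate in the corners,
and its determinant is -|1 - c|², so c = 1. -/
theorem IsQuantumChannel.map_ketBra_trans (hC : IsQuantumChannel C) {x y z : H}
    (hx : ‖x‖ = 1) (hy : ‖y‖ = 1) (hz : ‖z‖ = 1) (hfx : C (ketBra x x) = ketBra x x)
    (hfy : C (ketBra y y) = ketBra y y) (hfz : C (ketBra z z) = ketBra z z)
    (hxy : C (ketBra x y) = ketBra x y) (hyz : C (ketBra y z) = ketBra y z) :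
    C (ketBra x z) = ketBra x z := by
  have h := hC.map_ketBra_eq_smul hx hz hfx hfz
  set c := ⟪x, (C (ketBra x z)).1 z⟫_ℂ with hc
  have hp := (hC.blockPositive_map_ketBra ![x, y, z]).posSemidef ![x, y, z]
  have hu : ∀ u v : H, ‖u‖ = 1 → ‖v‖ = 1 → ⟪u, (ketBra u v).1 v⟫_ℂ = 1 := by
    intro u v hu hv
    simp [rankOne_apply, inner_self_eq_norm_sq_to_K, hu, hv]
  have h10 := hp.isHermitian.apply 1 0
  have h20 := hp.isHermitian.apply 2 0
  have h21 := hp.isHermitian.apply 2 1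
  have hd := hp.det_nonneg
  -- Entries below the diagonal become conjugates of those above, whose values are known.
  rw [Matrix.det_fin_three, ← h10, ← h20, ← h21] at hd
  simp only [Matrix.of_apply, Matrix.cons_val, hfx, hfy, hfz, hxy, hyz, hu _ _ hx hx, hu _ _ hy hy,
    hu _ _ hz hz, hu _ _ hx hy, hu _ _ hy hz, ← hc, star_one, mul_one, one_mul] at hd
  have h1 : 0 ≤ -(star (1 - c) * (1 - c)) := by
    convert hd using 1
    rw [star_sub, star_one]
    ring
  have h2 : (1 - c) = 0 := by
    rw [← CStarRing.star_mul_self_eq_zero_iff]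
    exact le_antisymm (neg_nonneg.1 h1) (star_mul_self_nonneg _)
  rw [h, ← sub_eq_zero.1 h2, one_smul]

/-! ### Continuity -/

theorem inner_apply_of_star_eq {R : H →L[ℂ] H} (hR : star R = R) (x y : H) :
    ⟪x, R y⟫_ℂ = ⟪R x, y⟫_ℂ := by
  conv_lhs => rw [← hR]
  rw [ContinuousLinearMap.star_eq_adjoint, ContinuousLinearMap.adjoint_inner_right]

/-- With T = R² and R self-adjoint, ⟨a, T a⟩ = ‖R a‖² and Tr T is the squared Hilbert-Schmidt norm
of R, which dominates the operator norm squared. -/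
theorem TraceClass.norm_inner_le_trace {T : TraceClass H} (hT : (0 : H →L[ℂ] H) ≤ T.1) (a : H) :
    ‖⟪a, T.1 a⟫_ℂ‖ ≤ ‖trace T‖ * ‖a‖ ^ 2 := by
  obtain ⟨R, hR, hRT⟩ := exists_sqrt hT
  have hin : ∀ b, ⟪b, T.1 b⟫_ℂ = ((‖R b‖ ^ 2 : ℝ) : ℂ) := by
    intro b
    rw [← hRT, inner_mul_self hR, inner_self_eq_norm_sq_to_K]
    norm_cast
  have hs : Summable fun i : basisSet H => ‖R (basis H i)‖ ^ 2 := by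
    have h : IsTraceClass T.1 := T.2
    unfold IsTraceClass at h
    rw [CFC.abs_of_nonneg _ hT] at h
    simpa only [hin, Complex.ofReal_re] using h
  have ht : ‖trace T‖ = ∑' i : basisSet H, ‖R (basis H i)‖ ^ 2 := by
    unfold trace
    simp only [hin]
    rw [← Complex.ofReal_tsum, Complex.norm_real, Real.norm_of_nonneg]
    exact tsum_nonneg fun i => by positivity
  have hle : ‖R a‖ₑ ^ 2 ≤ hsSq R * ‖a‖ₑ ^ 2 := by
    -- Parseval for R a, then Cauchy-Schwarz on each ⟨eᵢ, R a⟩ = ⟨R eᵢ, a⟩.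
    rw [← tsum_enorm_inner_sq (R a), hsSq, ← ENNReal.tsum_mul_right]
    refine ENNReal.tsum_le_tsum fun i => ?_
    rw [← mul_pow]
    gcongr
    rw [inner_apply_of_star_eq hR]
    simp only [← ofReal_norm, ← ENNReal.ofReal_mul (norm_nonneg _)]
    exact ENNReal.ofReal_le_ofReal (norm_inner_le_norm _ _)
  rw [hin, Complex.norm_real, Real.norm_of_nonneg (by positivity), ht]
  have h2 : hsSq R = ENNReal.ofReal (∑' i : basisSet H, ‖R (basis H i)‖ ^ 2) := by
    rw [ENNReal.ofReal_tsum_of_nonneg (fun i => by positivity) hs, hsSq]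
    simp only [ENNReal.ofReal_pow (norm_nonneg _), ofReal_norm]
  have h0 : 0 ≤ ∑' i : basisSet H, ‖R (basis H i)‖ ^ 2 := tsum_nonneg fun i => by positivity
  rw [h2, ← ofReal_norm, ← ofReal_norm, ← ENNReal.ofReal_pow (norm_nonneg _),
    ← ENNReal.ofReal_pow (norm_nonneg _), ← ENNReal.ofReal_mul h0,
    ENNReal.ofReal_le_ofReal_iff (by positivity)] at hle
  exact hle

theorem nonneg_of_inner_nonneg {E : Type*} [NormedAddCommGroup E] [InnerProductSpace ℂ E]
    {A : E →L[ℂ] E} (hA : ∀ a, 0 ≤ ⟪a, A a⟫_ℂ) : 0 ≤ A := by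
  rw [ContinuousLinearMap.nonneg_iff_isPositive, ContinuousLinearMap.isPositive_iff_complex]
  intro a
  have h2 : ⟪A a, a⟫_ℂ = ⟪a, A a⟫_ℂ := by
    rw [← inner_conj_symm]
    exact IsSelfAdjoint.of_nonneg (hA a)
  rw [h2]
  exact ⟨(Complex.eq_re_of_ofReal_le (r := 0) (by simpa using hA a)).symm,
    (Complex.nonneg_iff.1 (hA a)).1⟩

theorem le_iff_inner_le {A B : H →L[ℂ] H} : A ≤ B ↔ ∀ a, ⟪a, A a⟫_ℂ ≤ ⟪a, B a⟫_ℂ := by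
  refine ⟨fun h a => ?_, fun h => sub_nonneg.1 (nonneg_of_inner_nonneg fun a => ?_)⟩
  · have := ((ContinuousLinearMap.nonneg_iff_isPositive _).1 (sub_nonneg.2 h)).inner_nonneg_right a
    rwa [sub_apply, inner_sub_right, sub_nonneg] at this
  · rw [sub_apply, inner_sub_right, sub_nonneg]
    exact h a

theorem IsQuantumChannel.map_ketBra_self_nonneg (hC : IsQuantumChannel C) (u : H) :
    (0 : H →L[ℂ] H) ≤ (C (ketBra u u)).1 :=
  nonneg_of_inner_nonneg fun a => by
    simpa using hC.blockPositive_map_ketBra (fun _ : Fin 1 => u) fun _ => a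

/-- Trace preservation controls the diagonal blocks, as Tr C(|u⟩⟨u|) = ‖u‖², and Cauchy-Schwarz then
controls the off-diagonal one. -/
theorem IsQuantumChannel.norm_map_ketBra_le (hC : IsQuantumChannel C) (u v : H) :
    ‖(C (ketBra u v)).1‖ ≤ ‖u‖ * ‖v‖ := by
  have hself : ∀ u a : H, ‖⟪a, (C (ketBra u u)).1 a⟫_ℂ‖ ≤ ‖u‖ ^ 2 * ‖a‖ ^ 2 := by
    intro u a
    refine (TraceClass.norm_inner_le_trace (hC.map_ketBra_self_nonneg u) a).trans_eq ?_
    rw [hC.tracePreserving, trace_ketBra, inner_self_eq_norm_sq_to_K]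
    simp
  refine ContinuousLinearMap.opNorm_le_bound _ (by positivity) fun b => ?_
  set w := (C (ketBra u v)).1 b with hw
  -- Testing against w itself gives ‖w‖⁴ ≤ ‖u‖²‖w‖²‖v‖²‖b‖²; a factor ‖w‖² cancels when w ≠ 0.
  have h := (hC.norm_sq_inner_map_ketBra_le u v w b).trans
    (mul_le_mul (hself u w) (hself v b) (norm_nonneg _) (by positivity))
  rw [← hw, inner_self_eq_norm_sq_to_K, norm_pow, RCLike.norm_ofReal, abs_norm] at h
  rcases (norm_nonneg w).eq_or_lt' with h0 | h0
  · rw [h0]; positivity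
  · refine le_of_sq_le_sq ?_ (by positivity)
    refine le_of_mul_le_mul_left ?_ (pow_pos h0 2)
    linarith

/-- The map `(u, v) ↦ C(|u⟩⟨v|)` as a continuous sesquilinear map. -/
noncomputable def IsQuantumChannel.ketBraMap (hC : IsQuantumChannel C) :
    H →L[ℂ] H →L⋆[ℂ] (H →L[ℂ] H) :=
  LinearMap.mkContinuous₂
    (LinearMap.mk₂'ₛₗ (RingHom.id ℂ) (starRingEnd ℂ) (fun u v => (C (ketBra u v)).1)
      (fun u u' v => by simp) (fun c u v => by simp)
      (fun u v v' => by simp) (fun c u v => by simp)) 1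
    fun u v => by simpa using hC.norm_map_ketBra_le u v

/-- Two continuous sesquilinear maps agree on s × s; the agreement extends to the closed span in one
variable at a time. -/
theorem IsQuantumChannel.map_ketBra_of_mem_closure_span (hC : IsQuantumChannel C) {s : Set H}
    (hs : ∀ x ∈ s, ∀ y ∈ s, C (ketBra x y) = ketBra x y) {u v : H}
    (hu : u ∈ (Submodule.span ℂ s).topologicalClosure)
    (hv : v ∈ (Submodule.span ℂ s).topologicalClosure) :
    C (ketBra u v) = ketBra u v := by
  have h1 : ∀ y ∈ s, hC.ketBraMap u y = rankOne ℂ u y := by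
    intro y hy
    have h : Set.EqOn (hC.ketBraMap.flip y) ((rankOne ℂ).flip y) s := by
      intro x hx
      exact congrArg Subtype.val (hs x hx y hy)
    exact ContinuousLinearMap.eqOn_closure_span h hu
  have h : Set.EqOn (hC.ketBraMap u) (rankOne ℂ u) s := h1
  exact Subtype.ext (ContinuousLinearMap.eqOn_closure_span h hv)

/-! ### Density operators as suprema of finite sums of pure states -/

/-- R kills Sᗮ, because ‖R s‖² = ⟨s, R² s⟩ = 0 for s in Sᗮ; by self-adjointness its range lies in
Sᗮᗮ = S. -/
theorem apply_mem_of_mul_self_apply_mem {R : H →L[ℂ] H} (hR : star R = R) {S : Submodule ℂ H}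
    (hS : IsClosed (S : Set H)) (h : ∀ v, (R * R) v ∈ S) (v : H) : R v ∈ S := by
  have : CompleteSpace S := hS.completeSpace_coe
  rw [← S.orthogonal_orthogonal, Submodule.mem_orthogonal]
  intro s hs
  have h0 : R s = 0 := by
    rw [← inner_self_eq_zero (𝕜 := ℂ), ← inner_mul_self hR]
    exact Submodule.inner_left_of_mem_orthogonal (h s) hs
  rw [inner_apply_of_star_eq hR, h0, inner_zero_left]

/-- If `ρ = R²` then `ρ` is the supremum of the finite sums of `|R eᵢ⟩⟨R eᵢ|`. -/
theorem isLUB_sum_rankOne {R : H →L[ℂ] H} (hR : star R = R) :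
    IsLUB (Set.range fun F : Finset (basisSet H) =>
      ∑ i ∈ F, rankOne ℂ (R (basis H i)) (R (basis H i))) (R * R) := by
  -- Parseval for R a, read as weak convergence of the finite sums to R².
  have hsum : ∀ a, HasSum (fun i : basisSet H =>
      ⟪a, rankOne ℂ (R (basis H i)) (R (basis H i)) a⟫_ℂ) ⟪a, (R * R) a⟫_ℂ := by
    intro a
    rw [inner_mul_self hR]
    have h : ∀ i, ⟪a, rankOne ℂ (R (basis H i)) (R (basis H i)) a⟫_ℂ
        = ⟪R a, basis H i⟫_ℂ * ⟪basis H i, R a⟫_ℂ := by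
      intro i
      rw [rankOne_apply, inner_smul_right, inner_apply_of_star_eq hR a,
        inner_apply_of_star_eq hR (basis H i), mul_comm]
    simp only [h]
    exact (basis H).hasSum_inner_mul_inner (R a) (R a)
  have hnonneg : ∀ a i, 0 ≤ ⟪a, rankOne ℂ (R (basis H i)) (R (basis H i)) a⟫_ℂ := fun a i =>
    (isPositive_rankOne_self _).inner_nonneg_right a
  constructor
  · rintro _ ⟨F, rfl⟩
    refine le_iff_inner_le.2 fun a => ?_
    simp only [sum_apply, inner_sum]
    exact sum_le_hasSum F (fun i _ => hnonneg a i) (hsum a)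
  · intro T hT
    refine le_iff_inner_le.2 fun a => le_of_tendsto' (hsum a) fun F => ?_
    have h := le_iff_inner_le.1 (hT (Set.mem_range_self F)) a
    simpa only [sum_apply, inner_sum] using h

/-- The finite sums of `isLUB_sum_rankOne` are directed and each is fixed by `C`, so by normality
their images have supremum C(ρ); being the same operators, they also have supremum ρ. -/
theorem IsQuantumChannel.isDecoherenceFree (hC : IsQuantumChannel C) {S : Submodule ℂ H}
    (hS : IsClosed (S : Set H)) (h : ∀ u ∈ S, C (ketBra u u) = ketBra u u) :
    IsDecoherenceFree C S := by
  rintro ρ ⟨hρ, -⟩ hsupp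
  obtain ⟨R, hR, hRρ⟩ := exists_sqrt hρ
  have hRS : ∀ v, R v ∈ S := apply_mem_of_mul_self_apply_mem hR hS (by rwa [hRρ])
  let f : Finset (basisSet H) → TraceClass H := fun F =>
    ∑ i ∈ F, ketBra (R (basis H i)) (R (basis H i))
  have hval : ∀ F, (f F).1 = ∑ i ∈ F, rankOne ℂ (R (basis H i)) (R (basis H i)) := by
    intro F
    simp [f]
  have hCf : ∀ F, C (f F) = f F := by
    intro F
    simp only [f, map_sum]
    exact Finset.sum_congr rfl fun i _ => h _ (hRS _)
  have hpos : ∀ i, (0 : H →L[ℂ] H) ≤ rankOne ℂ (R (basis H i)) (R (basis H i)) := fun i =>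
    (ContinuousLinearMap.nonneg_iff_isPositive _).2 (isPositive_rankOne_self _)
  have hmono : Monotone fun F => (f F).1 := by
    intro F G hFG
    simp only [hval]
    exact Finset.sum_le_sum_of_subset_of_nonneg hFG fun i _ _ => hpos i
  have hlub : IsLUB ((fun σ : TraceClass H => σ.1) '' Set.range f) ρ.1 := by
    rw [← Set.range_comp, ← hRρ]
    simpa only [Function.comp_def, hval] using isLUB_sum_rankOne hR
  have hdir : DirectedOn (fun σ τ : TraceClass H => σ.1 ≤ τ.1) (Set.range f) :=
    directedOn_range.2 (hmono.directed_le)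
  have h1 := hC.normal (Set.range f) ρ (Set.range_nonempty f) hdir
    (by rintro _ ⟨F, rfl⟩; rw [hval]; exact Finset.sum_nonneg fun i _ => hpos i) hlub
  have h2 : (fun σ : TraceClass H => (C σ).1) '' Set.range f
      = (fun σ : TraceClass H => σ.1) '' Set.range f := by
    refine Set.image_congr ?_
    rintro _ ⟨F, rfl⟩
    rw [hCf]
  rw [h2] at h1
  exact Subtype.ext (h1.unique hlub)

/-! ### Connected components -/

/-- Induction along a walk: nonorthogonality handles each edge and transitivity joins the edges. -/
theorem IsQuantumChannel.map_ketBra_of_reachable (hC : IsQuantumChannel C) {X : Type*} {φ : X → H}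
    (hφ : ∀ x, ‖φ x‖ = 1) (hfix : ∀ x, C (ketBra (φ x) (φ x)) = ketBra (φ x) (φ x)) {x y : X}
    (h : (confusabilityGraph φ).Reachable x y) :
    C (ketBra (φ x) (φ y)) = ketBra (φ x) (φ y) := by
  obtain ⟨p⟩ := h
  induction p with
  | nil => exact hfix _
  | cons hadj _ ih =>
    exact hC.map_ketBra_trans (hφ _) (hφ _) (hφ _) (hfix _) (hfix _) (hfix _)
      (hC.map_ketBra_of_inner_ne_zero (hφ _) (hφ _) (hfix _) (hfix _) hadj.2) ih

end Confusability

theorem mainTheorem3 {H : Type*} [NormedAddCommGroup H] [InnerProductSpace ℂ H] [CompleteSpace H]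
    {X : Type*} (φ : X → H) (hφ : ∀ x, ‖φ x‖ = 1)
    (C : Confusability.TraceClass H →ₗ[ℂ] Confusability.TraceClass H)
    (hC : Confusability.IsQuantumChannel C)
    (hfix : ∀ x, C (Confusability.pureState (φ x)) = Confusability.pureState (φ x))
    (k : (Confusability.confusabilityGraph φ).ConnectedComponent) :
    Confusability.IsDecoherenceFree C (Confusability.componentSubspace φ k) := by
  refine hC.isDecoherenceFree (Submodule.isClosed_topologicalClosure _) fun u hu =>
    hC.map_ketBra_of_mem_closure_span ?_ hu hu
  rintro _ ⟨x, hx, rfl⟩ _ ⟨y, hy, rfl⟩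
  exact hC.map_ketBra_of_reachable hφ hfix
    (SimpleGraph.ConnectedComponent.exact (hx.trans hy.symm))
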